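/- Let $C$ be a coalgebra over a field $k$, and let $C^*=\mathrm{Hom}_k(C,k)$ be its dual algebra with the convolution product $(fg)(c)=\sum f(c_1)g(c_2)$. Regard $C$ as a right $C^*$-module by $c\cdot f=\sum f(c_1)c_2$, and suppose that $C$ is right co-Frobenius, that is, there is an injective morphism of right $C^*$-modules $C\to C^*$. Then for every simple left $C$-comodule $S$, the injective envelope $E(S)$ of $S$ in the category of left $C$-comodules has a unique maximal (proper) subcomodule. -/

import Mathlib

open scoped TensorProduct

universe u v

/-- A left comodule over the `k`-coalgebra `C`: a `k`-vector space `M` with a coassociative and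
counital structure map `ρ : M → C ⊗ M`, `ρ(m) = ∑ m₋₁ ⊗ m₀`. -/
class LeftComodule (k : Type u) (C : Type*) (M : Type*) [Field k]
    [AddCommGroup C] [Module k C] [Coalgebra k C] [AddCommGroup M] [Module k M] where
  /-- the structure map `ρ` -/
  coact : M →ₗ[k] C ⊗[k] M
  /-- `(Δ ⊗ id) ρ = (id ⊗ ρ) ρ` -/
  coassoc : (TensorProduct.assoc k C C M).toLinearMap ∘ₗ
    (Coalgebra.comul (R := k) (A := C)).rTensor M ∘ₗ coact = coact.lTensor C ∘ₗ coact
  /-- `(ε ⊗ id) ρ = 1 ⊗ id` -/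
  counit_coact : (Coalgebra.counit (R := k) (A := C)).rTensor M ∘ₗ coact = TensorProduct.mk k k M 1

namespace LeftComodule

section Basic

variable (k : Type u) (C : Type*) [Field k] [AddCommGroup C] [Module k C] [Coalgebra k C]

/-- `C` is a left comodule over itself through its comultiplication. -/
instance regular : LeftComodule k C C where
  coact := Coalgebra.comul
  coassoc := Coalgebra.coassoc
  counit_coact := Coalgebra.rTensor_counit_comp_comul

variable {M N : Type*} [AddCommGroup M] [Module k M] [LeftComodule k C M]
  [AddCommGroup N] [Module k N] [LeftComodule k C N]

/-- A linear map `f : M → N` is a morphism of left comodules: `ρ_N ∘ f = (id ⊗ f) ∘ ρ_M`. -/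
def IsHom (f : M →ₗ[k] N) : Prop :=
  (coact : N →ₗ[k] C ⊗[k] N) ∘ₗ f = f.lTensor C ∘ₗ (coact : M →ₗ[k] C ⊗[k] M)

/-- A subspace `V` of `M` is a subcomodule: `ρ(V) ⊆ C ⊗ V`. -/
def IsSubcomodule (V : Submodule k M) : Prop :=
  ∀ m ∈ V, (coact m : C ⊗[k] M) ∈ LinearMap.range (V.subtype.lTensor C)

/-- A maximal subcomodule: a proper subcomodule such that no proper subcomodule strictly
contains it. -/
def IsMaximalSubcomodule (V : Submodule k M) : Prop :=
  IsSubcomodule k C V ∧ V ≠ ⊤ ∧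
    ∀ W : Submodule k M, IsSubcomodule k C W → V ≤ W → W = V ∨ W = ⊤

variable (M) in
/-- A simple left comodule: it is nonzero, and its only subcomodules are `0` and itself. -/
def IsSimple : Prop :=
  Nontrivial M ∧ ∀ V : Submodule k M, IsSubcomodule k C V → V = ⊥ ∨ V = ⊤

/-- The right action of the dual algebra `C^*` (with the convolution product) on a left
`C`-comodule: `m · f = ∑ f(m₋₁) m₀`. -/
noncomputable def dualAct (m : M) (f : WithConv (C →ₗ[k] k)) : M :=
  TensorProduct.lid k M (f.ofConv.rTensor M (coact m : C ⊗[k] M))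

end Basic

section Injective

variable (k : Type u) (C : Type v) [Field k] [AddCommGroup C] [Module k C] [Coalgebra k C]

/-- `E` is an injective object of the category of left `C`-comodules. -/
def IsInjective (E : Type v) [AddCommGroup E] [Module k E] [LeftComodule k C E] : Prop :=
  ∀ (N P : Type v) [AddCommGroup N] [Module k N] [LeftComodule k C N]
    [AddCommGroup P] [Module k P] [LeftComodule k C P]
    (j : N →ₗ[k] P) (f : N →ₗ[k] E), IsHom k C j → Function.Injective j → IsHom k C f →
      ∃ g : P →ₗ[k] E, IsHom k C g ∧ g ∘ₗ j = f

/-- `i : S → E` is an injective envelope of `S` in the category of left `C`-comodules: `E` is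
injective and `i` is an essential monomorphism. -/
structure IsInjectiveEnvelope {S E : Type v} [AddCommGroup S] [Module k S] [LeftComodule k C S]
    [AddCommGroup E] [Module k E] [LeftComodule k C E] (i : S →ₗ[k] E) : Prop where
  isHom : IsHom k C i
  injective : Function.Injective i
  essential : ∀ V : Submodule k E, IsSubcomodule k C V → V ≠ ⊥ → V ⊓ LinearMap.range i ≠ ⊥
  isInjective : IsInjective k C E

end Injective

end LeftComodule

/-- `C` is right co-Frobenius: there is an injective morphism of right `C^*`-modules from `C`
to `C^*`. Here `C^*` is the dual algebra with the convolution product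
`(f * g)(c) = ∑ f(c₁) g(c₂)`, and `C` has the right action `c · f = ∑ f(c₁) c₂`. -/
def IsRightCoFrobenius (k : Type u) (C : Type*) [Field k] [AddCommGroup C] [Module k C]
    [Coalgebra k C] : Prop :=
  ∃ φ : C →ₗ[k] WithConv (C →ₗ[k] k), Function.Injective φ ∧
    ∀ (c : C) (f : WithConv (C →ₗ[k] k)), φ (LeftComodule.dualAct k C c f) = φ c * f

namespace LeftComodule

open WithConv

/-! Every nonzero subcomodule of `E` contains the socle `i(S)`, so a `C^*`-linear map out of `E`
that is nonzero somewhere on the socle is injective. This makes `E` a direct summand of `C`, and the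
co-Frobenius map restricts to an injective `C^*`-linear `θ : E → C^*`. Each `w` in `E` then gives an
endomorphism `x ↦ w · θ(x)`, with values in any subcomodule containing `w`. `E` is
finite-dimensional, and some `x₀` gives the identity. If `w` lies in a maximal subcomodule, its
endomorphism is not surjective, so not injective, so kills the socle. Two distinct maximal
subcomodules would sum to `E`, and splitting `x₀` accordingly would make the identity kill the
socle. -/

/-- An element of `C ⊗ X` all of whose slices `(f ⊗ id) t` vanish is zero. -/
lemma eq_zero_of_forall_rTensor_eq_zero {k C X : Type*} [Field k] [AddCommGroup C]
    [Module k C] [AddCommGroup X] [Module k X] (t : C ⊗[k] X)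
    (h : ∀ f : C →ₗ[k] k, f.rTensor X t = 0) : t = 0 := by
  classical
  let b := Module.Basis.ofVectorSpace k C
  apply (TensorProduct.equivFinsuppOfBasisLeft (N := X) b).injective
  rw [map_zero]
  ext i
  have key : ∀ t : C ⊗[k] X, TensorProduct.equivFinsuppOfBasisLeft b t i =
      TensorProduct.lid k X ((b.coord i).rTensor X t) := by
    intro t
    induction t with
    | zero => simp
    | tmul c m => simp
    | add x y hx hy => simp only [map_add, Finsupp.add_apply, hx, hy]
  rw [key, h]
  simp

/-! ### Comodules as modules over the dual algebra -/

section Action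

variable {k : Type u} {C : Type*} [Field k] [AddCommGroup C] [Module k C] [Coalgebra k C]
  {M N : Type*} [AddCommGroup M] [Module k M] [LeftComodule k C M]
  [AddCommGroup N] [Module k N] [LeftComodule k C N]

variable (k C M) in
/-- The right action of the dual algebra on a left comodule, as a bilinear map. -/
noncomputable def dualActHom : M →ₗ[k] WithConv (C →ₗ[k] k) →ₗ[k] M :=
  LinearMap.mk₂ k (dualAct k C)
    (fun m n f => by simp [dualAct]) (fun a m f => by simp [dualAct])
    (fun m f g => by simp [dualAct, LinearMap.rTensor_add])
    (fun a m f => by simp [dualAct, LinearMap.rTensor_smul])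

@[simp] lemma dualActHom_apply (m : M) (f : WithConv (C →ₗ[k] k)) :
    dualActHom k C M m f = dualAct k C m f := rfl

lemma IsHom.map_dualAct {g : M →ₗ[k] N} (hg : IsHom k C g) (m : M) (f : WithConv (C →ₗ[k] k)) :
    g (dualAct k C m f) = dualAct k C (g m) f := by
  have h : ∀ t : C ⊗[k] M, g (TensorProduct.lid k M (f.ofConv.rTensor M t)) =
      TensorProduct.lid k N (f.ofConv.rTensor N (g.lTensor C t)) := by
    intro t
    induction t with
    | zero => simp
    | tmul c m => simp
    | add x y hx hy => simp only [map_add, hx, hy]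
  have hm : (coact (g m) : C ⊗[k] N) = g.lTensor C (coact m) := LinearMap.congr_fun hg m
  rw [dualAct, dualAct, h, hm]

lemma dualAct_mul (m : M) (f g : WithConv (C →ₗ[k] k)) :
    dualAct k C m (f * g) = dualAct k C (dualAct k C m f) g := by
  have h₁ : ∀ t : C ⊗[k] M, (coact (TensorProduct.lid k M (f.ofConv.rTensor M t)) : C ⊗[k] M) =
      TensorProduct.lid k _ (f.ofConv.rTensor _ ((coact : M →ₗ[k] C ⊗[k] M).lTensor C t)) := by
    intro t
    induction t with
    | zero => simp
    | tmul c m => simp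
    | add x y hx hy => simp only [map_add, hx, hy]
  have h₂ : ∀ (u : C ⊗[k] C) (n : M),
      TensorProduct.lid k M (g.ofConv.rTensor M (TensorProduct.lid k _
        (f.ofConv.rTensor _ (TensorProduct.assoc k C C M (u ⊗ₜ[k] n))))) =
      LinearMap.mul' k k (TensorProduct.map f.ofConv g.ofConv u) • n := by
    intro u n
    induction u with
    | zero => simp
    | tmul a b => simp [mul_smul]
    | add x y hx hy => simp only [TensorProduct.add_tmul, map_add, hx, hy, add_smul]
  have h₃ : ∀ t : C ⊗[k] M,
      TensorProduct.lid k M ((f * g).ofConv.rTensor M t) =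
      TensorProduct.lid k M (g.ofConv.rTensor M (TensorProduct.lid k _
        (f.ofConv.rTensor _ (TensorProduct.assoc k C C M
          ((Coalgebra.comul (R := k) (A := C)).rTensor M t))))) := by
    intro t
    induction t with
    | zero => simp
    | tmul c m =>
      rw [LinearMap.rTensor_tmul, LinearMap.rTensor_tmul, h₂, TensorProduct.lid_tmul]
      rfl
    | add x y hx hy => simp only [map_add, hx, hy]
  have hm := LinearMap.congr_fun (coassoc (k := k) (C := C) (M := M)) m
  simp only [LinearMap.comp_apply, LinearEquiv.coe_coe] at hm
  rw [dualAct, dualAct, dualAct, h₁, h₃, hm]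

/-- Evaluating a functional on `c · g`. -/
lemma ofConv_dualAct (c : C) (f g : WithConv (C →ₗ[k] k)) :
    f.ofConv (dualAct k C c g) = (g * f).ofConv c := by
  have h : ∀ t : C ⊗[k] C, f.ofConv (TensorProduct.lid k C (g.ofConv.rTensor C t)) =
      LinearMap.mul' k k (TensorProduct.map g.ofConv f.ofConv t) := by
    intro t
    induction t with
    | zero => simp
    | tmul a b => simp
    | add x y hx hy => simp only [map_add, hx, hy]
  exact h _

lemma IsSubcomodule.dualAct_mem {V : Submodule k M} (hV : IsSubcomodule k C V) {m : M}
    (hm : m ∈ V) (f : WithConv (C →ₗ[k] k)) : dualAct k C m f ∈ V := by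
  obtain ⟨t, ht⟩ := hV m hm
  have h : ∀ t : C ⊗[k] V,
      TensorProduct.lid k M (f.ofConv.rTensor M (V.subtype.lTensor C t)) ∈ V := by
    intro t
    induction t with
    | zero => simp
    | tmul c m => simpa using V.smul_mem _ m.2
    | add x y hx hy => simpa only [map_add] using V.add_mem hx hy
  rw [dualAct, ← ht]
  exact h t

/-- By exactness of `C ⊗ -`, it is enough that the image of `ρ(m)` in `C ⊗ M/V` vanishes, and slices
detect this. -/
lemma isSubcomodule_of_dualAct_mem {V : Submodule k M}
    (hV : ∀ m ∈ V, ∀ f : WithConv (C →ₗ[k] k), dualAct k C m f ∈ V) : IsSubcomodule k C V := by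
  intro m hm
  have hex : Function.Exact (V.subtype.lTensor C) (V.mkQ.lTensor C) :=
    lTensor_exact C (LinearMap.exact_subtype_mkQ V) V.mkQ_surjective
  refine (hex _).1 (eq_zero_of_forall_rTensor_eq_zero _ fun f => ?_)
  apply (TensorProduct.lid k (M ⧸ V)).injective
  rw [map_zero]
  have h : ∀ t : C ⊗[k] M, TensorProduct.lid k (M ⧸ V) (f.rTensor _ (V.mkQ.lTensor C t)) =
      V.mkQ (TensorProduct.lid k M (f.rTensor M t)) := by
    intro t
    induction t with
    | zero => simp
    | tmul c m => simp
    | add x y hx hy => simp only [map_add, hx, hy]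
  rw [h]
  exact (Submodule.Quotient.mk_eq_zero V).2 (hV m hm (toConv f))

lemma IsSubcomodule.sup {V W : Submodule k M} (hV : IsSubcomodule k C V)
    (hW : IsSubcomodule k C W) : IsSubcomodule k C (V ⊔ W) := by
  refine isSubcomodule_of_dualAct_mem fun m hm f => ?_
  obtain ⟨v, hv, w, hw, rfl⟩ := Submodule.mem_sup.1 hm
  rw [← dualActHom_apply, map_add]
  exact Submodule.add_mem_sup (hV.dualAct_mem hv f) (hW.dualAct_mem hw f)

lemma isSubcomodule_ker {g : M →ₗ[k] N}
    (hg : ∀ m (f : WithConv (C →ₗ[k] k)), g (dualAct k C m f) = dualAct k C (g m) f) :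
    IsSubcomodule k C (LinearMap.ker g) := by
  refine isSubcomodule_of_dualAct_mem fun m hm f => ?_
  rw [LinearMap.mem_ker] at hm ⊢
  rw [hg, hm, ← dualActHom_apply, map_zero, LinearMap.zero_apply]

lemma IsSubcomodule.comap {V : Submodule k N} (hV : IsSubcomodule k C V) {g : M →ₗ[k] N}
    (hg : IsHom k C g) : IsSubcomodule k C (V.comap g) :=
  isSubcomodule_of_dualAct_mem fun m hm f => by
    rw [Submodule.mem_comap, hg.map_dualAct]
    exact hV.dualAct_mem hm f

/-- The elements `m · f` with `m` fixed span a finite-dimensional space. -/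
lemma finiteDimensional_range_dualActHom (m : M) :
    FiniteDimensional k (LinearMap.range (dualActHom k C M m)) := by
  obtain ⟨s, hs⟩ := TensorProduct.exists_finset (coact m : C ⊗[k] M)
  have : LinearMap.range (dualActHom k C M m) ≤
      Submodule.span k (Prod.snd '' (s : Set (C × M))) := by
    rintro _ ⟨f, rfl⟩
    rw [dualActHom_apply, dualAct, hs, map_sum, map_sum]
    refine Submodule.sum_mem _ fun i hi => ?_
    rw [LinearMap.rTensor_tmul, TensorProduct.lid_tmul]
    exact Submodule.smul_mem _ _ (Submodule.subset_span ⟨i, hi, rfl⟩)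
  have := FiniteDimensional.span_of_finite k ((s.finite_toSet).image (Prod.snd (α := C) (β := M)))
  exact Submodule.finiteDimensional_of_le ‹_ ≤ _›

variable (C) in
/-- The morphism `m ↦ ∑ l(m₀) m₋₁` of left comodules `M → C` given by a functional `l`. -/
noncomputable def coefficient (l : M →ₗ[k] k) : M →ₗ[k] C :=
  (TensorProduct.rid k C).toLinearMap ∘ₗ l.lTensor C ∘ₗ coact

lemma isHom_coefficient (l : M →ₗ[k] k) : IsHom k C (coefficient C l) := by
  have h₂ : ∀ (u : C ⊗[k] C) (n : M),
      ((TensorProduct.rid k C).toLinearMap ∘ₗ l.lTensor C).lTensor C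
        (TensorProduct.assoc k C C M (u ⊗ₜ[k] n)) = l n • u := by
    intro u n
    induction u with
    | zero => simp
    | tmul a b => simp
    | add x y hx hy => simp only [TensorProduct.add_tmul, map_add, hx, hy, smul_add]
  have h₃ : ∀ t : C ⊗[k] M,
      ((TensorProduct.rid k C).toLinearMap ∘ₗ l.lTensor C).lTensor C (TensorProduct.assoc k C C M
          ((Coalgebra.comul (R := k) (A := C)).rTensor M t)) =
        Coalgebra.comul (R := k) (TensorProduct.rid k C (l.lTensor C t)) := by
    intro t
    induction t with
    | zero => simp
    | tmul c m => rw [LinearMap.rTensor_tmul, h₂]; simp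
    | add x y hx hy => simp only [map_add, hx, hy]
  refine LinearMap.ext fun m => ?_
  have hm := LinearMap.congr_fun (coassoc (k := k) (C := C) (M := M)) m
  simp only [LinearMap.comp_apply, LinearEquiv.coe_coe] at hm
  have := h₃ (coact m)
  rw [hm, ← LinearMap.comp_apply, ← LinearMap.lTensor_comp] at this
  exact this.symm

/-- Since `ε` recovers `l`, the coefficient map is nonzero wherever `l` is. -/
lemma counit_coefficient (l : M →ₗ[k] k) (m : M) :
    Coalgebra.counit (R := k) (coefficient C l m) = l m := by
  have h : ∀ t : C ⊗[k] M,
      Coalgebra.counit (R := k) (TensorProduct.rid k C (l.lTensor C t)) =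
        l (TensorProduct.lid k M ((Coalgebra.counit (R := k) (A := C)).rTensor M t)) := by
    intro t
    induction t with
    | zero => simp
    | tmul c m => simp [mul_comm]
    | add x y hx hy => simp only [map_add, hx, hy]
  have hm := LinearMap.congr_fun (counit_coact (k := k) (C := C) (M := M)) m
  simp only [LinearMap.comp_apply] at hm
  refine (h (coact m)).trans ?_
  simp [hm]

end Action

/-! ### Injective envelopes of simple comodules -/

section Envelope

variable {k : Type u} {C : Type v} [Field k] [AddCommGroup C] [Module k C] [Coalgebra k C]
  {S : Type v} [AddCommGroup S] [Module k S] [LeftComodule k C S]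
  {E : Type v} [AddCommGroup E] [Module k E] [LeftComodule k C E] {i : S →ₗ[k] E}

/-- A nonzero subcomodule of the injective envelope of a simple comodule contains its socle. -/
lemma IsInjectiveEnvelope.range_le (hi : IsInjectiveEnvelope k C i) (hS : IsSimple k C S)
    {V : Submodule k E} (hV : IsSubcomodule k C V) (hne : V ≠ ⊥) : LinearMap.range i ≤ V := by
  rcases hS.2 _ (hV.comap hi.isHom) with h | h
  · refine absurd ?_ (hi.essential V hV hne)
    rw [Submodule.eq_bot_iff]
    rintro _ ⟨hx, s, rfl⟩
    have hs : s ∈ V.comap i := hx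
    rw [h, Submodule.mem_bot] at hs
    rw [hs, map_zero]
  · rintro _ ⟨s, rfl⟩
    have hs : s ∈ V.comap i := h ▸ Submodule.mem_top
    exact hs

/-- A `C^*`-linear map on the injective envelope of a simple comodule is injective as soon as it
does not vanish at some element of the socle. -/
lemma IsInjectiveEnvelope.injective_of_apply_ne_zero (hi : IsInjectiveEnvelope k C i)
    (hS : IsSimple k C S) {N : Type*} [AddCommGroup N] [Module k N] [LeftComodule k C N]
    {g : E →ₗ[k] N}
    (hg : ∀ m (f : WithConv (C →ₗ[k] k)), g (dualAct k C m f) = dualAct k C (g m) f)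
    {s : S} (hs : g (i s) ≠ 0) : Function.Injective g := by
  rw [← LinearMap.ker_eq_bot]
  by_contra hne
  exact hs (hi.range_le hS (isSubcomodule_ker hg) hne ⟨s, rfl⟩)

/-- The injective envelope of a simple comodule is a direct summand of `C`. -/
lemma IsInjectiveEnvelope.exists_retract (hi : IsInjectiveEnvelope k C i) (hS : IsSimple k C S) :
    ∃ (j : E →ₗ[k] C) (p : C →ₗ[k] E), IsHom k C j ∧ IsHom k C p ∧ p ∘ₗ j = LinearMap.id := by
  obtain ⟨s, hs⟩ := @exists_ne S hS.1 0
  have his : i s ≠ 0 := fun h => hs (hi.injective (h.trans (map_zero i).symm))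
  obtain ⟨l, hl⟩ : ∃ l : E →ₗ[k] k, l (i s) ≠ 0 := by
    by_contra! h
    exact his ((Module.forall_dual_apply_eq_zero_iff k (i s)).1 h)
  have hj : IsHom k C (coefficient C l) := isHom_coefficient l
  have hinj : Function.Injective (coefficient C l) :=
    hi.injective_of_apply_ne_zero hS hj.map_dualAct (s := s) fun h => hl <| by
      rw [← counit_coefficient (C := C), h, map_zero]
  obtain ⟨p, hp, hpj⟩ := hi.isInjective E C (coefficient C l) LinearMap.id hj hinj
    (by simp [IsHom])
  exact ⟨_, p, hj, hp, hpj⟩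

/-- The injective envelope of a simple left comodule over a right co-Frobenius coalgebra is
finite-dimensional, and some morphism of `C^*`-modules `E → C^*` has a retraction of the form
`f ↦ x₀ · f`. -/
lemma IsInjectiveEnvelope.finiteDimensional_and_exists (hi : IsInjectiveEnvelope k C i)
    (hS : IsSimple k C S) (hC : IsRightCoFrobenius k C) :
    FiniteDimensional k E ∧ ∃ (θ : E →ₗ[k] WithConv (C →ₗ[k] k)) (x₀ : E),
      (∀ x f, θ (dualAct k C x f) = θ x * f) ∧ ∀ x, dualAct k C x₀ (θ x) = x := by
  obtain ⟨φ, hφ, hφm⟩ := hC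
  obtain ⟨j, p, hj, hp, hpj⟩ := hi.exists_retract hS
  have hpj' : ∀ x, p (j x) = x := LinearMap.congr_fun hpj
  let θ : E →ₗ[k] WithConv (C →ₗ[k] k) := φ ∘ₗ j
  have hθ : ∀ x f, θ (dualAct k C x f) = θ x * f := fun x f => by
    simp only [θ, LinearMap.comp_apply, hj.map_dualAct, hφm]
  have hθinj : Function.Injective θ := hφ.comp (Function.LeftInverse.injective hpj')
  have hfin : FiniteDimensional k E := by
    obtain ⟨s, hs⟩ := @exists_ne S hS.1 0
    have hθs : θ (i s) ≠ 0 := fun h =>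
      hs (hi.injective ((hθinj (h.trans (map_zero θ).symm)).trans (map_zero i).symm))
    obtain ⟨d, hd⟩ : ∃ d, (θ (i s)).ofConv d ≠ 0 := by
      by_contra! h
      exact hθs (WithConv.ext (LinearMap.ext h))
    -- The map `x ↦ d · θ(x)` lands in the finite-dimensional space `d · C^*`; it is nonzero at `i
    -- s` because `ε(d · θ(i s)) = θ(i s)(d)`.
    have hg : Function.Injective (dualActHom k C C d ∘ₗ θ) := by
      refine hi.injective_of_apply_ne_zero hS (s := s) (fun m f => ?_) fun h => hd ?_
      · simp only [LinearMap.comp_apply, dualActHom_apply, hθ, dualAct_mul]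
      · have h' := ofConv_dualAct d (1 : WithConv (C →ₗ[k] k)) (θ (i s))
        rw [mul_one] at h'
        have h₀ : dualAct k C d (θ (i s)) = 0 := h
        rw [← h', h₀, map_zero]
    have := finiteDimensional_range_dualActHom (k := k) (C := C) d
    refine FiniteDimensional.of_injective
      (((dualActHom k C C d).rangeRestrict) ∘ₗ θ) fun x y hxy => hg (congrArg Subtype.val hxy)
  refine ⟨hfin, θ, ?_⟩
  -- As `E` is finite-dimensional and `θ` injective, every functional on `E` has the form `x ↦
  -- θ(x)(d)`; take the functional `ε ∘ j`.
  obtain ⟨d, hd⟩ : ∃ d, ∀ x, (θ x).ofConv d = Coalgebra.counit (R := k) (j x) := by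
    let B : E →ₗ[k] C →ₗ[k] k := (WithConv.linearEquiv k (C →ₗ[k] k)).toLinearMap ∘ₗ θ
    have hB : Function.Surjective B.flip := LinearMap.flip_surjective_iff₁.2
      ((WithConv.linearEquiv k (C →ₗ[k] k)).injective.comp hθinj)
    obtain ⟨d, hd⟩ := hB (Coalgebra.counit (R := k) ∘ₗ j)
    exact ⟨d, LinearMap.congr_fun hd⟩
  refine ⟨p d, hθ, fun x => ?_⟩
  rw [← hp.map_dualAct]
  suffices dualAct k C d (θ x) = j x by rw [this, hpj']
  -- For each functional `f`: `f(d · θ(x)) = (θ(x) * f)(d) = θ(x · f)(d) = ε(j(x) · f) = f(j(x))`.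
  rw [← sub_eq_zero, ← Module.forall_dual_apply_eq_zero_iff k]
  intro f
  have h₁ := ofConv_dualAct d (toConv f) (θ x)
  have h₂ := ofConv_dualAct (j x) (1 : WithConv (C →ₗ[k] k)) (toConv f)
  rw [mul_one] at h₂
  rw [← hθ, hd, hj.map_dualAct] at h₁
  rw [map_sub, sub_eq_zero]
  exact h₁.trans h₂

/-- Two maximal subcomodules of the injective envelope of a simple comodule coincide. -/
lemma IsInjectiveEnvelope.maximal_unique (hi : IsInjectiveEnvelope k C i)
    (hS : IsSimple k C S) (hC : IsRightCoFrobenius k C) {V W : Submodule k E}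
    (hV : IsMaximalSubcomodule k C V) (hW : IsMaximalSubcomodule k C W) : V = W := by
  obtain ⟨hfin, θ, x₀, hθ, hx₀⟩ := hi.finiteDimensional_and_exists hS hC
  by_contra hne
  have hsup : V ⊔ W = ⊤ := by
    refine (hV.2.2 _ (hV.1.sup hW.1) le_sup_left).resolve_left fun h => ?_
    rcases hW.2.2 V hV.1 (sup_eq_left.1 h) with h' | h'
    exacts [hne h', hV.2.1 h']
  obtain ⟨z, hz, y, hy, hzy⟩ := Submodule.mem_sup.1 (hsup ▸ Submodule.mem_top : x₀ ∈ V ⊔ W)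
  have haction : ∀ (w x : E) (f : WithConv (C →ₗ[k] k)),
      (dualActHom k C E w ∘ₗ θ) (dualAct k C x f) =
        dualAct k C ((dualActHom k C E w ∘ₗ θ) x) f := fun w x f => by
    simp only [LinearMap.comp_apply, dualActHom_apply, hθ, dualAct_mul]
  -- The image lies in the proper subspace `U`, while an injective endomorphism of a
  -- finite-dimensional space is onto.
  have hnot : ∀ {U : Submodule k E} {w : E}, IsMaximalSubcomodule k C U → w ∈ U →
      ¬ Function.Injective (dualActHom k C E w ∘ₗ θ) := fun {U w} hU hw hinj =>
    hU.2.1 <| (Submodule.eq_top_iff').2 fun x => by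
      obtain ⟨x', rfl⟩ := LinearMap.injective_iff_surjective.1 hinj x
      exact hU.1.dualAct_mem hw _
  have hzero : ∀ {U : Submodule k E} {w : E}, IsMaximalSubcomodule k C U → w ∈ U →
      ∀ s, dualAct k C w (θ (i s)) = 0 := fun hU hw s => by
    by_contra h
    exact hnot hU hw (hi.injective_of_apply_ne_zero hS (haction _) (s := s) h)
  obtain ⟨s, hs⟩ := @exists_ne S hS.1 0
  refine hs (hi.injective ?_)
  rw [map_zero, ← hx₀ (i s), ← hzy, ← dualActHom_apply, map_add, LinearMap.add_apply,
    dualActHom_apply, dualActHom_apply, hzero hV hz, hzero hW hy, add_zero]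

/-- A nonzero finite-dimensional comodule has a maximal subcomodule. -/
lemma exists_isMaximalSubcomodule {M : Type*} [AddCommGroup M] [Module k M] [LeftComodule k C M]
    [FiniteDimensional k M] [Nontrivial M] : ∃ V : Submodule k M, IsMaximalSubcomodule k C V := by
  have hbot : IsSubcomodule k C (⊥ : Submodule k M) := fun m hm => by
    rw [(Submodule.mem_bot k).1 hm, map_zero]
    exact Submodule.zero_mem _
  obtain ⟨V, ⟨hV, hVtop⟩, hmax⟩ := (wellFounded_gt (α := Submodule k M)).has_min
    {V | IsSubcomodule k C V ∧ V ≠ ⊤} ⟨⊥, hbot, bot_ne_top⟩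
  refine ⟨V, hV, hVtop, fun W hW hVW => ?_⟩
  by_contra! h
  exact hmax W ⟨hW, h.2⟩ (lt_of_le_of_ne hVW h.1.symm)

end Envelope

end LeftComodule

theorem mainTheorem11 (k : Type u) (C : Type v) [Field k]
    [AddCommGroup C] [Module k C] [Coalgebra k C] (hC : IsRightCoFrobenius k C)
    (S : Type v) [AddCommGroup S] [Module k S] [LeftComodule k C S]
    (hS : LeftComodule.IsSimple k C S)
    (E : Type v) [AddCommGroup E] [Module k E] [LeftComodule k C E]
    (i : S →ₗ[k] E) (hi : LeftComodule.IsInjectiveEnvelope k C i) :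
    ∃! V : Submodule k E, LeftComodule.IsMaximalSubcomodule k C V := by

  have := (hi.finiteDimensional_and_exists hS hC).1
  have := hS.1
  have : Nontrivial E := hi.injective.nontrivial
  obtain ⟨V, hV⟩ := LeftComodule.exists_isMaximalSubcomodule (k := k) (C := C) (M := E)
  exact ⟨V, hV, fun W hW => hi.maximal_unique hS hC hW hV⟩
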